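/- Super Faà di Bruno formula. For $n,m\ge 0$ let $C^\infty(\mathbb{R}^{n|m})=C^\infty(\mathbb{R}^n)\otimes_{\mathbb R}\Lambda(\xi^1,\dots,\xi^m)$ be the $\mathbb{Z}_2$-graded algebra of smooth functions of even coordinates $x^1,\dots,x^n$ and odd coordinates $\xi^1,\dots,\xi^m$. Collective indices $a$ run over all coordinates $x^a$, even and odd, and $\tilde a\in\mathbb{Z}_2$ is the parity of $x^a$. Even partial derivatives act on the coefficients; $\partial/\partial\xi^\mu$ is the left derivative: it is linear over $C^\infty(\mathbb{R}^n)$, kills $1$ and satisfies $\frac{\partial}{\partial \xi^\mu}(\xi^\nu\omega)=\delta^\nu_\mu\,\omega-\xi^\nu\frac{\partial\omega}{\partial\xi^\mu}$. A smooth map $y:\mathbb{R}^{n_1|m_1}\to\mathbb{R}^{n_2|m_2}$ is a family of superfunctions $y^b\in C^\infty(\mathbb{R}^{n_1|m_1})$, one for each coordinate index $b$ of $\mathbb{R}^{n_2|m_2}$, where $y^b$ has parity $\tilde b$. For $f\in C^\infty(\mathbb{R}^{n_2|m_2})$, $f(y(x))\in C^\infty(\mathbb{R}^{n_1|m_1})$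 is obtained by replacing the odd coordinates by the odd components $y^b$, and each coefficient function by its (finite) formal Taylor expansion about the numerical part $y_0$ of the even components, evaluated on their nilpotent parts $y^b-y_0^b$. Let $y:\mathbb{R}^{n_1|m_1}\to\mathbb{R}^{n_2|m_2}$ be a smooth map, $f\in C^\infty(\mathbb{R}^{n_2|m_2})$ (not necessarily homogeneous), $n\ge 0$, and let $a_1,\dots,a_n$ be coordinate indices of $\mathbb{R}^{n_1|m_1}$ (repetitions allowed). A partition $\pi$ of $\{a_1,\dots,a_n\}$ means a set partition of the $n$ labels $1,\dots,n$. Order the set as $(a_n,\dots,a_1)$, so that $a_n$ comes first. Each block of $\pi$ inherits this ordering, and the blocks are ordered by their last elements as $B^1_\pi,\dots,B^{|\pi|}_\pi$. Listing the blocks one after the other, each in its inherited order, gives a new ordering; $\pi(i)$ denotes the rank of $a_i$ in it, and $$\tilde\pi=\sum_{\substack{1\le i<j\le n\\ \pi(i)<\pi(j)}}\tilde a_i\tilde a_j \mod 2 .$$ Then $$\frac{\partial}{\partial x^{a_n}}\cdots\frac{\partial}{\partial x^{a_1}} f(y(x))=\sum_{\pi}\ \sum_{b_1,\dots,b_{|\pi|}}(-1)^{\tilde\pi}\left(\prod_{i=1}^{|\pi|}(-1)^{\tilde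 b_i\left(\sum_{k=i+1}^{|\pi|}\left(\tilde b_k+\sum_{\ell\in B^k_\pi}\tilde a_\ell\right)\right)}\,\partial_{B^i_\pi}y^{b_i}(x)\right)\left(\frac{\partial}{\partial y^{b_1}}\cdots\frac{\partial}{\partial y^{b_{|\pi|}}}f\right)(y(x)),$$ where $\pi$ runs over all partitions of $\{a_1,\dots,a_n\}$ and each $b_i$ over all coordinate indices of $\mathbb{R}^{n_2|m_2}$. The product over $i$ is ordered, with $i=1$ leftmost, and $\partial_{B}=\frac{\partial}{\partial x^{a_{j_1}}}\cdots\frac{\partial}{\partial x^{a_{j_r}}}$ for a block $B$ that is listed in its inherited order as $(a_{j_1},\dots,a_{j_r})$. -/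

import Mathlib

open scoped TensorProduct ContDiff Manifold

noncomputable section

namespace SuperCalc

/-- The algebra `C^∞(ℝⁿ)` of real-valued smooth functions on `ℝⁿ`. -/
abbrev Smooth (n : ℕ) : Type := C^∞⟮𝓘(ℝ, Fin n → ℝ), Fin n → ℝ; 𝓘(ℝ, ℝ), ℝ⟯

/-- The real Grassmann algebra `Λ(ξ¹, …, ξᵐ)`; the generator `ξ^μ` is `ι ℝ (Pi.single μ 1)`. -/
abbrev Grassmann (m : ℕ) : Type := ExteriorAlgebra ℝ (Fin m → ℝ)

/-- The algebra `C^∞(ℝ^{n|m}) = C^∞(ℝⁿ) ⊗ Λ(ξ¹, …, ξᵐ)` of smooth functions on the superspace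
`ℝ^{n|m}`: polynomials in the odd coordinates whose coefficients are smooth functions of the even
coordinates. -/
abbrev SuperFun (n m : ℕ) : Type := Smooth n ⊗[ℝ] Grassmann m

/-- Collective indices of the coordinates of `ℝ^{n|m}`: `Sum.inl i` stands for the even coordinate
`xⁱ` and `Sum.inr μ` for the odd coordinate `ξ^μ`. -/
abbrev Index (n m : ℕ) : Type := Fin n ⊕ Fin m

/-- The parity of a collective index. -/
def parity {n m : ℕ} : Index n m → ZMod 2
  | Sum.inl _ => 0
  | Sum.inr _ => 1

/-- The sign `(-1)^p` of a parity `p`. -/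
def sign (p : ZMod 2) : ℤˣ := (-1 : ℤˣ) ^ p

/-- The superfunctions of parity `p`: the image of `C^∞(ℝⁿ) ⊗ Λ_p`, where `Λ_p` is the even part
(`p = 0`) or the odd part (`p = 1`) of the Grassmann algebra. -/
def parityPart (n m : ℕ) (p : ZMod 2) : Submodule ℝ (SuperFun n m) :=
  LinearMap.range (LinearMap.lTensor (Smooth n)
    (CliffordAlgebra.evenOdd (0 : QuadraticForm ℝ (Fin m → ℝ)) p).subtype)

section Differentiation

/-- The partial derivative `∂g/∂xⁱ` of a smooth function on `ℝⁿ`. -/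
def smoothPartialFun {n : ℕ} (i : Fin n) (g : Smooth n) : Smooth n :=
  ⟨fun x => fderiv ℝ g x (Pi.single i 1), by
    have hg : ContDiff ℝ ∞ g := g.contMDiff.contDiff
    exact ((hg.fderiv_right (m := ∞) (by simp)).clm_apply contDiff_const).contMDiff⟩

/-- The partial derivative `∂/∂xⁱ` as a linear operator on `C^∞(ℝⁿ)`. -/
def smoothPartial {n : ℕ} (i : Fin n) : Module.End ℝ (Smooth n) where
  toFun := smoothPartialFun i
  map_add' f g := by
    have hf : ContDiff ℝ ∞ f := f.contMDiff.contDiff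
    have hg : ContDiff ℝ ∞ g := g.contMDiff.contDiff
    ext x
    change fderiv ℝ (⇑f + ⇑g) x (Pi.single i 1) = _
    rw [fderiv_add (hf.differentiable (by simp) x) (hg.differentiable (by simp) x)]
    rfl
  map_smul' c f := by
    have hf : ContDiff ℝ ∞ f := f.contMDiff.contDiff
    ext x
    change fderiv ℝ (c • ⇑f) x (Pi.single i 1) = _
    rw [fderiv_const_smul (hf.differentiable (by simp) x)]
    rfl

/-- The (left) partial derivative with respect to a collective coordinate. An even derivative acts
on the coefficients. An odd derivative `∂/∂ξ^μ` is the contraction `D` with the `μ`-th coordinate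
form, i.e. the operator, linear over functions of the even coordinates, with `D 1 = 0` and
`D (ξ^ν ω) = δ^ν_μ ω - ξ^ν D ω`. -/
def partialD {n m : ℕ} : Index n m → Module.End ℝ (SuperFun n m)
  | Sum.inl i => LinearMap.rTensor (Grassmann m) (smoothPartial i)
  | Sum.inr μ => LinearMap.lTensor (Smooth n)
      (CliffordAlgebra.contractLeft (Q := (0 : QuadraticForm ℝ (Fin m → ℝ)))
        (LinearMap.proj μ : Module.Dual ℝ (Fin m → ℝ)))

/-- The iterated derivative `∂_{c 0} ∘ ∂_{c 1} ∘ ⋯ ∘ ∂_{c (k-1)}` (the last one acts first). -/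
def iterD {n m k : ℕ} (c : Fin k → Index n m) : Module.End ℝ (SuperFun n m) :=
  (List.ofFn fun j => partialD (c j)).prod

end Differentiation

section Substitution

/-- The numerical part `h(x, 0)` of a superfunction `h(x, ξ)`. -/
def numPart {n m : ℕ} : SuperFun n m →ₗ[ℝ] Smooth n :=
  (TensorProduct.rid ℝ (Smooth n)).toLinearMap ∘ₗ
    LinearMap.lTensor (Smooth n) (ExteriorAlgebra.algebraMapInv (R := ℝ)).toLinearMap

/-- A function of the even coordinates, seen as a superfunction. -/
def ofSmooth (n m : ℕ) : Smooth n →ₗ[ℝ] SuperFun n m :=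
  (Algebra.TensorProduct.includeLeft : Smooth n →ₐ[ℝ] SuperFun n m).toLinearMap

/-- The nilpotent supplement `h_+ = h - h(x, 0)` of a superfunction `h`. -/
def nilPart {n m : ℕ} (h : SuperFun n m) : SuperFun n m :=
  h - ofSmooth n m (numPart h)

/-- Composition `g ↦ g(u¹, …, uᵏ)` of ordinary smooth functions. -/
def smoothComp {n k : ℕ} (u : Fin k → Smooth n) : Smooth k →ₗ[ℝ] Smooth n where
  toFun g := ⟨fun x => g fun i => u i x, by
    have hg : ContDiff ℝ ∞ g := g.contMDiff.contDiff
    have hu : ContDiff ℝ ∞ fun x => fun i => u i x :=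
      contDiff_pi.2 fun i => (u i).contMDiff.contDiff
    exact (hg.comp hu).contMDiff⟩
  map_add' _ _ := rfl
  map_smul' _ _ := rfl

/-- A smooth map of superspaces `ℝ^{n₁|m₁} → ℝ^{n₂|m₂}`, given by its components `y^b`, an even
superfunction for each even index `b` and an odd superfunction for each odd index `b`. -/
structure SuperMap (n₁ m₁ n₂ m₂ : ℕ) where
  /-- The components of the map. -/
  comp : Index n₂ m₂ → SuperFun n₁ m₁
  /-- The components have the parity of their index. -/
  comp_mem : ∀ b, comp b ∈ parityPart n₁ m₁ (parity b)

/-- Odd superfunctions anticommute. -/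
theorem odd_mul_odd {n m : ℕ} {z w : SuperFun n m} (hz : z ∈ parityPart n m 1)
    (hw : w ∈ parityPart n m 1) : z * w = -(w * z) := by
  obtain ⟨s, rfl⟩ := hz
  obtain ⟨t, rfl⟩ := hw
  induction s using TensorProduct.induction_on with
  | zero => simp
  | add s s' hs hs' => rw [map_add, add_mul, mul_add, hs, hs', neg_add]
  | tmul a p =>
    induction t using TensorProduct.induction_on with
    | zero => simp
    | add t t' ht ht' => rw [map_add, mul_add, add_mul, ht, ht', neg_add]
    | tmul b q =>
      have h := CliffordAlgebra.map_mul_map_eq_neg_of_isOrtho_of_mem_evenOdd_one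
        (QuadraticMap.Isometry.id (0 : QuadraticForm ℝ (Fin m → ℝ)))
        (QuadraticMap.Isometry.id (0 : QuadraticForm ℝ (Fin m → ℝ)))
        (fun _ _ => by simp [QuadraticMap.IsOrtho]) _ _ p.2 q.2
      simp only [CliffordAlgebra.map_id, AlgHom.id_apply] at h
      simp only [LinearMap.lTensor_tmul, Submodule.subtype_apply,
        Algebra.TensorProduct.tmul_mul_tmul]
      rw [h, mul_comm a b, neg_mul, TensorProduct.tmul_neg]

/-- Odd superfunctions square to zero. -/
theorem odd_sq {n m : ℕ} {z : SuperFun n m} (hz : z ∈ parityPart n m 1) : z * z = 0 := by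
  have h := odd_mul_odd hz hz
  have h2 : (2 : ℝ) • (z * z) = 0 := by
    rw [two_smul]
    nth_rewrite 1 [h]
    exact neg_add_cancel _
  exact (smul_eq_zero.1 h2).resolve_left two_ne_zero

variable {n₁ m₁ n₂ m₂ : ℕ}

/-- The linear map `v ↦ ∑_α v_α ζ^α`, where `ζ^α` are the odd components of a smooth map. -/
def SuperMap.oddLinear (y : SuperMap n₁ m₁ n₂ m₂) : (Fin m₂ → ℝ) →ₗ[ℝ] SuperFun n₁ m₁ :=
  Fintype.linearCombination ℝ fun α => y.comp (Sum.inr α)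

/-- Substitution of the odd components: the algebra homomorphism
`Λ(ζ¹, …, ζ^{m₂}) → C^∞(ℝ^{n₁|m₁})` that sends each generator to the corresponding odd component
of the map. -/
def SuperMap.oddSubst (y : SuperMap n₁ m₁ n₂ m₂) : Grassmann m₂ →ₐ[ℝ] SuperFun n₁ m₁ :=
  ExteriorAlgebra.lift ℝ ⟨y.oddLinear, fun v => odd_sq <| by
    rw [SuperMap.oddLinear, Fintype.linearCombination_apply]
    exact Submodule.sum_mem _ fun α _ => Submodule.smul_mem _ _ (y.comp_mem (Sum.inr α))⟩

/-- Substitution of the even components in a smooth function `g` on `ℝ^{n₂}` (Grassmannian analytic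
continuation): the formal Taylor series
`∑_k 1/k! ∑_{b_1, …, b_k} y_+^{b_1} ⋯ y_+^{b_k} (∂_{b_1} ⋯ ∂_{b_k} g)(y_0)`
at the numerical part `y_0` of the even components. All terms with `k > m₁` vanish, because each
`y_+^b` has no part of degree `0` in the `m₁` odd coordinates. -/
def SuperMap.evenSubst (y : SuperMap n₁ m₁ n₂ m₂) : Smooth n₂ →ₗ[ℝ] SuperFun n₁ m₁ :=
  ∑ k ∈ Finset.range (m₁ + 1), ((Nat.factorial k : ℝ)⁻¹) • ∑ b : Fin k → Fin n₂,
    LinearMap.mulLeft ℝ (List.ofFn fun j => nilPart (y.comp (Sum.inl (b j)))).prod ∘ₗ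
      ofSmooth n₁ m₁ ∘ₗ
      smoothComp (fun i => numPart (y.comp (Sum.inl i))) ∘ₗ
      ((List.ofFn fun j => smoothPartial (b j)).prod : Module.End ℝ (Smooth n₂))

/-- The substitution (pullback) `f ↦ f(y(x))`, determined by
`g ω ↦ g(y) ω(ζ)` for a smooth function `g` of the even coordinates and `ω` in the Grassmann
algebra. -/
def SuperMap.pullback (y : SuperMap n₁ m₁ n₂ m₂) : SuperFun n₂ m₂ →ₗ[ℝ] SuperFun n₁ m₁ :=
  TensorProduct.lift
    ((LinearMap.mul ℝ (SuperFun n₁ m₁)).compl₁₂ y.evenSubst y.oddSubst.toLinearMap)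

end Substitution

section Partitions

/-! A family `a : Fin n → Index N M` stands for the indices `a_1, …, a_n` (`a i` is `a_{i+1}`). The
ordered set `{a_n, …, a_1}` is listed from left to right by the positions `p : Fin n`, with the
element `a p.rev` at position `p`. Set partitions are `OrderedFinpartition n`, partitions of the
positions: the increasing enumeration of the block number `i` is `π.emb i`, and the
`π.length` blocks are numbered by increasing last element. -/

variable {n N M : ℕ}

/-- The indices in the `i`-th block of a partition of the ordered set `{a_n, …, a_1}`, listed in
the inherited order. -/
def blockIndices (π : OrderedFinpartition n) (a : Fin n → Index N M) (i : Fin π.length) :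
    Fin (π.partSize i) → Index N M :=
  fun j => a (π.emb i j).rev

/-- The ranking of the index `a_i` in the ordering defined by `π`: the blocks one after the other,
each in its inherited order. Ranks live in a lexicographically ordered product
(number of the block, position in `(a_n, …, a_1)`). -/
def rank (π : OrderedFinpartition n) (i : Fin n) : Fin π.length ×ₗ Fin n :=
  toLex (π.index i.rev, i.rev)

/-- The parity `π̃ = ∑ ã_i ã_j` of a partition, the sum over the pairs `i < j` for which
`a_i` precedes `a_j` in the ordering defined by `π`. -/
def partitionParity (π : OrderedFinpartition n) (a : Fin n → Index N M) : ZMod 2 :=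
  ∑ p : Fin n × Fin n with p.1 < p.2 ∧ rank π p.1 < rank π p.2, parity (a p.1) * parity (a p.2)

/-- The exponent `b̃_i (∑_{k > i} (b̃_k + ∑_{ℓ ∈ B^k} ã_ℓ))` of the internal sign of the `i`-th
block. -/
def internalParity {N' M' : ℕ} (π : OrderedFinpartition n) (a : Fin n → Index N M)
    (b : Fin π.length → Index N' M') (i : Fin π.length) : ZMod 2 :=
  parity (b i) * ∑ k with i < k, (parity (b k) + ∑ j, parity (blockIndices π a k j))

end Partitions

end SuperCalc

end

open scoped TensorProduct ContDiff Manifold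

noncomputable section

namespace SuperCalc

/-! ### Signs -/

/-! The formula is proved by induction on the number of derivatives. Applying one more derivative
`∂_a` to the term of a partition `π` is governed by the graded Leibniz rule for an ordered product
(`partialD_prod_ofFn_mul`) and the chain rule (`SuperMap.partialD_pullback`). If `∂_a` hits the
factor of the block `i`, then `a` joins that block as its first element. If it hits `f(y)`, the
chain rule creates a factor `∂_a y^{b₀}`; moved to the front, it is a new first block `{a}`. Since
the new label comes first in the ordering, these are the partitions `extendMiddle i` and
`extendLeft`, and each partition of the larger set arises exactly once
(`OrderedFinpartition.extendEquiv`).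

The signs match separately. Reaching the factor `i` costs `ã ∑_{k<i} (B̃_k + b̃_k)`: the `B̃_k` part
is the change of `π̃`, the `b̃_k` part the change of the internal signs. Reaching `f(y)` costs `ã P`
with `P = ∑_k (B̃_k + b̃_k)`, and moving the new factor to the front costs `(ã + b̃₀) P`; the total
`b̃₀ P` is the internal exponent of the new block, and `π̃` does not change.

For the chain rule, a pure tensor is a product of an even and an odd substitution. The odd one is an
algebra homomorphism, treated by induction on generators. The even one is a Taylor sum:
differentiating the term of degree `k` turns `1/k!` into `1/(k-1)!`, and the only term not matched
on the other side has degree above `m₁` in the odd coordinates, hence vanishes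
(`SuperMap.partialD_evenSubst`). -/

@[simp] theorem sign_zero : sign 0 = 1 := uzpow_zero _

theorem sign_one : sign 1 = -1 := uzpow_one _

theorem sign_add (p q : ZMod 2) : sign (p + q) = sign p * sign q := uzpow_add _ _ _

theorem sign_one_smul {E : Type*} [AddCommGroup E] (v : E) : sign 1 • v = -v := by
  rw [sign_one, Units.neg_smul, one_smul]

theorem map_sign_smul {E F : Type*} [AddCommGroup E] [AddCommGroup F] [Module ℝ E] [Module ℝ F]
    (T : E →ₗ[ℝ] F) (p : ZMod 2) (v : E) : T (sign p • v) = sign p • T v := by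
  rw [Units.smul_def, Units.smul_def, map_zsmul]

/-! ### The contraction on the Grassmann algebra -/

section Grassmann

variable {m : ℕ}

local notation "Q₀" => (0 : QuadraticForm ℝ (Fin m → ℝ))

theorem evenOdd_mul_comm {p q : ZMod 2} {θ η : Grassmann m}
    (hθ : θ ∈ CliffordAlgebra.evenOdd Q₀ p) (hη : η ∈ CliffordAlgebra.evenOdd Q₀ q) :
    θ * η = sign (p * q) • (η * θ) := by
  have h := CliffordAlgebra.map_mul_map_of_isOrtho_of_mem_evenOdd
    (QuadraticMap.Isometry.id Q₀) (QuadraticMap.Isometry.id Q₀)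
    (fun _ _ => by simp [QuadraticMap.IsOrtho]) _ _ hθ hη
  simp only [CliffordAlgebra.map_id, AlgHom.id_apply] at h
  rw [mul_comm p q]
  exact h

/-- The rule on one generator propagates by induction on the left factor. The grade involution
carries the sign, so `θ` may be inhomogeneous. -/
theorem contractLeft_mul (d : Module.Dual ℝ (Fin m → ℝ)) (θ η : CliffordAlgebra Q₀) :
    CliffordAlgebra.contractLeft d (θ * η) =
      CliffordAlgebra.contractLeft d θ * η +
        CliffordAlgebra.involute θ * CliffordAlgebra.contractLeft d η := by
  induction θ using CliffordAlgebra.left_induction with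
  | algebraMap r =>
    rw [CliffordAlgebra.contractLeft_algebraMap_mul, CliffordAlgebra.contractLeft_algebraMap,
      AlgHom.commutes, zero_mul, zero_add]
  | add x y hx hy => simp only [add_mul, map_add, hx, hy]; abel
  | ι_mul x v hx =>
    rw [mul_assoc, CliffordAlgebra.contractLeft_ι_mul, hx, CliffordAlgebra.contractLeft_ι_mul,
      map_mul, CliffordAlgebra.involute_ι]
    simp only [mul_add, sub_mul, smul_mul_assoc, mul_assoc, neg_mul]
    abel

theorem involute_of_mem_evenOdd {p : ZMod 2} {θ : CliffordAlgebra Q₀}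
    (hθ : θ ∈ CliffordAlgebra.evenOdd Q₀ p) : CliffordAlgebra.involute θ = sign p • θ := by
  revert hθ
  fin_cases p
  · intro hθ
    exact (CliffordAlgebra.involute_eq_of_mem_even hθ).trans (one_smul _ _).symm
  · intro hθ
    exact (CliffordAlgebra.involute_eq_of_mem_odd hθ).trans (sign_one_smul _).symm

theorem contractLeft_mem_evenOdd (d : Module.Dual ℝ (Fin m → ℝ)) {p : ZMod 2}
    {θ : CliffordAlgebra Q₀} (hθ : θ ∈ CliffordAlgebra.evenOdd Q₀ p) :
    CliffordAlgebra.contractLeft d θ ∈ CliffordAlgebra.evenOdd Q₀ (p + 1) := by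
  induction θ, hθ using CliffordAlgebra.evenOdd_induction with
  | range_ι_pow v h =>
    revert h
    fin_cases p
    · intro h
      obtain ⟨r, rfl⟩ := Submodule.mem_one.mp h
      rw [CliffordAlgebra.contractLeft_algebraMap]
      exact Submodule.zero_mem _
    · intro h
      obtain ⟨r, rfl⟩ := (pow_one (LinearMap.range (CliffordAlgebra.ι Q₀))).le h
      rw [CliffordAlgebra.contractLeft_ι]
      -- The contraction of a vector is a scalar, and `1 + 1 = 0` is its parity.
      exact (SetLike.algebraMap_mem_graded (CliffordAlgebra.evenOdd Q₀) _ :)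
  | add x y hx hy ihx ihy => rw [map_add]; exact Submodule.add_mem _ ihx ihy
  | ι_mul_ι_mul v w x hx ih =>
    rw [mul_assoc, CliffordAlgebra.contractLeft_ι_mul, CliffordAlgebra.contractLeft_ι_mul]
    have hι (u) : CliffordAlgebra.ι Q₀ u ∈ CliffordAlgebra.evenOdd Q₀ 1 :=
      CliffordAlgebra.ι_mem_evenOdd_one _ _
    have h1 (u) : CliffordAlgebra.ι Q₀ u * x ∈ CliffordAlgebra.evenOdd Q₀ (p + 1) := by
      rw [add_comm]; exact SetLike.mul_mem_graded (hι u) hx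
    refine Submodule.sub_mem _ (Submodule.smul_mem _ _ (h1 w)) ?_
    rw [mul_sub, mul_smul_comm, ← mul_assoc]
    refine Submodule.sub_mem _ (Submodule.smul_mem _ _ (h1 v)) ?_
    have := SetLike.mul_mem_graded (CliffordAlgebra.ι_mul_ι_mem_evenOdd_zero Q₀ v w) ih
    rwa [zero_add] at this

end Grassmann

/-! ### Parity of superfunctions -/

section Parity

variable {n m : ℕ}

theorem tmul_mem_parityPart {p : ZMod 2} (g : Smooth n) {θ : Grassmann m}
    (hθ : θ ∈ CliffordAlgebra.evenOdd (0 : QuadraticForm ℝ (Fin m → ℝ)) p) :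
    g ⊗ₜ[ℝ] θ ∈ parityPart n m p :=
  ⟨g ⊗ₜ ⟨θ, hθ⟩, rfl⟩

@[elab_as_elim]
theorem parityPart_induction {p : ZMod 2} {P : SuperFun n m → Prop} (zero : P 0)
    (add : ∀ u v, P u → P v → P (u + v))
    (tmul : ∀ (g : Smooth n) (θ : Grassmann m),
      θ ∈ CliffordAlgebra.evenOdd (0 : QuadraticForm ℝ (Fin m → ℝ)) p → P (g ⊗ₜ θ))
    {u : SuperFun n m} (hu : u ∈ parityPart n m p) : P u := by
  obtain ⟨s, rfl⟩ := hu
  induction s using TensorProduct.induction_on with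
  | zero => rwa [map_zero]
  | add s t hs ht => rw [map_add]; exact add _ _ hs ht
  | tmul g θ => exact tmul g θ θ.2

theorem one_mem_parityPart : (1 : SuperFun n m) ∈ parityPart n m 0 :=
  tmul_mem_parityPart 1 (SetLike.one_mem_graded _)

theorem ofSmooth_mem_parityPart (g : Smooth n) : ofSmooth n m g ∈ parityPart n m 0 :=
  tmul_mem_parityPart g (SetLike.one_mem_graded _)

theorem mul_mem_parityPart {p q : ZMod 2} {u v : SuperFun n m} (hu : u ∈ parityPart n m p)
    (hv : v ∈ parityPart n m q) : u * v ∈ parityPart n m (p + q) := by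
  refine parityPart_induction ?_ ?_ ?_ hu
  · rw [zero_mul]; exact Submodule.zero_mem _
  · intro u u' h h'; rw [add_mul]; exact Submodule.add_mem _ h h'
  · intro g θ hθ
    refine parityPart_induction ?_ ?_ ?_ hv
    · rw [mul_zero]; exact Submodule.zero_mem _
    · intro u u' h h'; rw [mul_add]; exact Submodule.add_mem _ h h'
    · intro h η hη
      rw [Algebra.TensorProduct.tmul_mul_tmul]
      exact tmul_mem_parityPart _ (SetLike.mul_mem_graded hθ hη)

theorem mul_comm_of_mem_parityPart {p q : ZMod 2} {u v : SuperFun n m}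
    (hu : u ∈ parityPart n m p) (hv : v ∈ parityPart n m q) :
    u * v = sign (p * q) • (v * u) := by
  refine parityPart_induction ?_ ?_ ?_ hu
  · simp
  · intro u u' h h'; rw [add_mul, mul_add, smul_add, h, h']
  · intro g θ hθ
    refine parityPart_induction ?_ ?_ ?_ hv
    · simp
    · intro u u' h h'; rw [add_mul, mul_add, smul_add, h, h']
    · intro h η hη
      rw [Algebra.TensorProduct.tmul_mul_tmul, Algebra.TensorProduct.tmul_mul_tmul,
        evenOdd_mul_comm hθ hη, mul_comm g h, ← TensorProduct.mk_apply, map_sign_smul,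
        TensorProduct.mk_apply]

/-- Splitting the Grassmann factor of `v` into even and odd parts reduces to homogeneous factors, so
no parity is needed for `v`. -/
theorem commute_of_mem_parityPart_zero {u : SuperFun n m} (hu : u ∈ parityPart n m 0)
    (v : SuperFun n m) : Commute u v := by
  induction v using TensorProduct.induction_on with
  | zero => exact Commute.zero_right _
  | add v w hv hw => exact hv.add_right hw
  | tmul g θ =>
    obtain ⟨θ₀, h₀, θ₁, h₁, rfl⟩ := Submodule.mem_sup.1 <|
      (CliffordAlgebra.evenOdd_isCompl (Q := (0 : QuadraticForm ℝ (Fin m → ℝ)))).sup_eq_top ▸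
        Submodule.mem_top (x := θ)
    rw [TensorProduct.tmul_add]
    refine Commute.add_right ?_ ?_
    · have := mul_comm_of_mem_parityPart hu (tmul_mem_parityPart g h₀)
      rwa [zero_mul, sign_zero, one_smul] at this
    · have := mul_comm_of_mem_parityPart hu (tmul_mem_parityPart g h₁)
      rwa [zero_mul, sign_zero, one_smul] at this

/-! ### Partial derivatives -/

theorem partialD_mem_parityPart (a : Index n m) {p : ZMod 2} {u : SuperFun n m}
    (hu : u ∈ parityPart n m p) : partialD a u ∈ parityPart n m (parity a + p) := by
  refine parityPart_induction ?_ ?_ ?_ hu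
  · rw [map_zero]; exact Submodule.zero_mem _
  · intro u u' h h'; rw [map_add]; exact Submodule.add_mem _ h h'
  · intro g θ hθ
    cases a with
    | inl i =>
      rw [parity, zero_add]
      exact tmul_mem_parityPart _ hθ
    | inr μ =>
      rw [parity, add_comm]
      exact tmul_mem_parityPart _ (contractLeft_mem_evenOdd _ hθ)

theorem smoothPartial_mul (i : Fin n) (g h : Smooth n) :
    smoothPartial i (g * h) = smoothPartial i g * h + g * smoothPartial i h := by
  have hg : ContDiff ℝ ∞ g := g.contMDiff.contDiff
  have hh : ContDiff ℝ ∞ h := h.contMDiff.contDiff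
  ext x
  change fderiv ℝ (⇑g * ⇑h) x (Pi.single i 1) =
    fderiv ℝ g x (Pi.single i 1) * h x + g x * fderiv ℝ h x (Pi.single i 1)
  rw [fderiv_mul (hg.differentiable (by simp) x) (hh.differentiable (by simp) x)]
  simp only [add_apply, smul_apply, smul_eq_mul]
  ring

theorem smoothPartial_commute (i j : Fin n) : Commute (smoothPartial i) (smoothPartial j) := by
  refine LinearMap.ext fun g => ?_
  have hg : ContDiff ℝ ∞ g := g.contMDiff.contDiff
  have hd : Differentiable ℝ (fderiv ℝ g) :=
    (hg.fderiv_right (m := ∞) (by simp)).differentiable (by simp)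
  have key (k l : Fin n) (x) : smoothPartial k (smoothPartial l g) x =
      fderiv ℝ (fderiv ℝ g) x (Pi.single k 1) (Pi.single l 1) := by
    change fderiv ℝ (fun x => fderiv ℝ g x (Pi.single l 1)) x (Pi.single k 1) = _
    rw [fderiv_clm_apply (hd x) (differentiableAt_const _)]
    simp
  ext x
  change smoothPartial i (smoothPartial j g) x = smoothPartial j (smoothPartial i g) x
  rw [key, key]
  exact (hg.contDiffAt.isSymmSndFDerivAt (by simpa using WithTop.coe_le_coe.2 (le_top : (2 : ℕ∞) ≤ ⊤))) _ _

theorem partialD_mul (a : Index n m) {p : ZMod 2} {u : SuperFun n m}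
    (hu : u ∈ parityPart n m p) (v : SuperFun n m) :
    partialD a (u * v) = partialD a u * v + sign (parity a * p) • (u * partialD a v) := by
  refine parityPart_induction ?_ ?_ ?_ hu
  · simp
  · intro u u' h h'; simp only [add_mul, map_add, h, h', smul_add]; abel
  · intro g θ hθ
    induction v using TensorProduct.induction_on with
    | zero => simp
    | add v w hv hw => simp only [mul_add, map_add, hv, hw, smul_add]; abel
    | tmul h η =>
      cases a with
      | inl i =>
        simp only [parity, zero_mul, sign_zero, one_smul, partialD,
          Algebra.TensorProduct.tmul_mul_tmul, LinearMap.rTensor_tmul, smoothPartial_mul,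
          TensorProduct.add_tmul]
      | inr μ =>
        have hc := contractLeft_mul (LinearMap.proj μ) θ η
        rw [involute_of_mem_evenOdd hθ, smul_mul_assoc] at hc
        simp only [parity, one_mul, partialD, Algebra.TensorProduct.tmul_mul_tmul,
          LinearMap.lTensor_tmul]
        refine (congrArg (TensorProduct.mk ℝ (Smooth n) (Grassmann m) (g * h)) hc).trans ?_
        rw [map_add]
        exact congrArg _ (map_sign_smul _ _ _)

theorem partialD_mul_of_even (a : Index n m) {u : SuperFun n m}
    (hu : u ∈ parityPart n m 0) (v : SuperFun n m) :
    partialD a (u * v) = partialD a u * v + u * partialD a v := by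
  rw [partialD_mul a hu, mul_zero, sign_zero, one_smul]

end Parity

/-! ### Nilpotency -/

section Nilpotency

variable {n m : ℕ}

theorem grassmann_induction {P : Grassmann m → Prop}
    (algebraMap : ∀ r : ℝ, P (algebraMap ℝ (Grassmann m) r))
    (add : ∀ x y, P x → P y → P (x + y)) (ι_mul : ∀ x v, P x → P (ExteriorAlgebra.ι ℝ v * x))
    (θ : Grassmann m) : P θ :=
  CliffordAlgebra.left_induction _ algebraMap add ι_mul θ

/-- The elements of the Grassmann algebra all of whose terms have degree at least `k`. -/
def grassmannFiltration (m k : ℕ) : Submodule ℝ (Grassmann m) :=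
  LinearMap.range (ExteriorAlgebra.ι ℝ (M := Fin m → ℝ)) ^ k * ⊤

theorem ι_mul_mem_grassmannFiltration_one (v : Fin m → ℝ) (θ : Grassmann m) :
    ExteriorAlgebra.ι ℝ v * θ ∈ grassmannFiltration m 1 := by
  rw [grassmannFiltration, pow_one]
  exact Submodule.mul_mem_mul ⟨v, rfl⟩ trivial

/-- This makes the filtration multiplicative. For `k = 1`, a scalar commutes with a vector, and a
product that begins with a vector is already of the required form; anticommutation plays no role. -/
theorem top_mul_range_ι_pow_le (k : ℕ) :
    (⊤ : Submodule ℝ (Grassmann m)) * LinearMap.range (ExteriorAlgebra.ι ℝ) ^ k ≤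
      LinearMap.range (ExteriorAlgebra.ι ℝ) ^ k * ⊤ := by
  have h1 : (⊤ : Submodule ℝ (Grassmann m)) * LinearMap.range (ExteriorAlgebra.ι ℝ) ≤
      LinearMap.range (ExteriorAlgebra.ι ℝ) * ⊤ := by
    rw [Submodule.mul_le]
    rintro θ - _ ⟨v, rfl⟩
    induction θ using grassmann_induction with
    | algebraMap r =>
      rw [Algebra.commutes]
      exact Submodule.mul_mem_mul ⟨v, rfl⟩ trivial
    | add x y hx hy => rw [add_mul]; exact Submodule.add_mem _ hx hy
    | ι_mul x w hx => rw [mul_assoc]; exact Submodule.mul_mem_mul ⟨w, rfl⟩ trivial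
  induction k with
  | zero => simp
  | succ k ih =>
    calc _ = ⊤ * LinearMap.range (ExteriorAlgebra.ι ℝ) ^ k *
          LinearMap.range (ExteriorAlgebra.ι ℝ) := by rw [pow_succ, mul_assoc]
      _ ≤ LinearMap.range (ExteriorAlgebra.ι ℝ) ^ k * ⊤ * LinearMap.range (ExteriorAlgebra.ι ℝ) :=
        mul_le_mul' ih le_rfl
      _ ≤ LinearMap.range (ExteriorAlgebra.ι ℝ) ^ k *
          (LinearMap.range (ExteriorAlgebra.ι ℝ) * ⊤) := by
        rw [mul_assoc]; exact mul_le_mul' le_rfl h1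
      _ = _ := by rw [pow_succ, mul_assoc]

theorem mul_mem_grassmannFiltration {k l : ℕ} {θ η : Grassmann m}
    (hθ : θ ∈ grassmannFiltration m k) (hη : η ∈ grassmannFiltration m l) :
    θ * η ∈ grassmannFiltration m (k + l) := by
  have h : grassmannFiltration m k * grassmannFiltration m l ≤ grassmannFiltration m (k + l) := by
    simp only [grassmannFiltration]
    calc _ = LinearMap.range (ExteriorAlgebra.ι ℝ) ^ k *
          (⊤ * LinearMap.range (ExteriorAlgebra.ι ℝ) ^ l) * ⊤ := by simp only [mul_assoc]
      _ ≤ LinearMap.range (ExteriorAlgebra.ι ℝ) ^ k *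
          (LinearMap.range (ExteriorAlgebra.ι ℝ) ^ l * ⊤) * ⊤ :=
        mul_le_mul' (mul_le_mul' le_rfl (top_mul_range_ι_pow_le l)) le_rfl
      _ = LinearMap.range (ExteriorAlgebra.ι ℝ) ^ (k + l) * (⊤ * ⊤) := by
        simp only [pow_add, mul_assoc]
      _ ≤ _ := mul_le_mul' le_rfl le_top
  exact h (Submodule.mul_mem_mul hθ hη)

/-- Products of `m + 1` vectors are values of an alternating map, and `m + 1` vectors of `ℝᵐ` are
linearly dependent. -/
theorem grassmannFiltration_eq_bot : grassmannFiltration m (m + 1) = ⊥ := by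
  have h : LinearMap.range (ExteriorAlgebra.ι ℝ (M := Fin m → ℝ)) ^ (m + 1) = ⊥ := by
    refine (ExteriorAlgebra.ιMulti_span_fixedDegree ℝ (m + 1)).symm.trans ?_
    rw [Submodule.span_eq_bot]
    rintro _ ⟨v, rfl⟩
    refine AlternatingMap.map_linearDependent _ _ fun hv => ?_
    simpa using hv.fintype_card_le_finrank
  rw [grassmannFiltration, h, Submodule.bot_mul]

theorem sub_algebraMapInv_mem (θ : Grassmann m) :
    θ - algebraMap ℝ _ (ExteriorAlgebra.algebraMapInv θ) ∈ grassmannFiltration m 1 := by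
  induction θ using grassmann_induction with
  | algebraMap r =>
    have h : ExteriorAlgebra.algebraMapInv (algebraMap ℝ (Grassmann m) r) = r :=
      ExteriorAlgebra.algebraMap_leftInverse _ r
    rw [h, sub_self]
    exact Submodule.zero_mem _
  | add x y hx hy =>
    rw [map_add, map_add, add_sub_add_comm]
    exact Submodule.add_mem _ hx hy
  | ι_mul x v hx =>
    have h : ExteriorAlgebra.algebraMapInv (ExteriorAlgebra.ι ℝ v * x) = 0 := by
      simp [ExteriorAlgebra.algebraMapInv]
    rw [h, map_zero, sub_zero]
    exact ι_mul_mem_grassmannFiltration_one v x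

theorem evenOdd_one_le_grassmannFiltration :
    CliffordAlgebra.evenOdd (0 : QuadraticForm ℝ (Fin m → ℝ)) 1 ≤ grassmannFiltration m 1 := by
  intro θ hθ
  induction θ, hθ using CliffordAlgebra.odd_induction with
  | ι v =>
    have := ι_mul_mem_grassmannFiltration_one v 1
    rwa [mul_one] at this
  | add x y hx hy ihx ihy => exact Submodule.add_mem _ ihx ihy
  | ι_mul_ι_mul v w x hx ih =>
    rw [mul_assoc]
    exact ι_mul_mem_grassmannFiltration_one v _

/-- The superfunctions all of whose terms have degree at least `k` in the odd coordinates. -/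
def superFiltration (n m k : ℕ) : Submodule ℝ (SuperFun n m) :=
  LinearMap.range (LinearMap.lTensor (Smooth n) (grassmannFiltration m k).subtype)

theorem tmul_mem_superFiltration {k : ℕ} (g : Smooth n) {θ : Grassmann m}
    (hθ : θ ∈ grassmannFiltration m k) : g ⊗ₜ[ℝ] θ ∈ superFiltration n m k :=
  ⟨g ⊗ₜ ⟨θ, hθ⟩, rfl⟩

@[elab_as_elim]
theorem superFiltration_induction {k : ℕ} {P : SuperFun n m → Prop} (zero : P 0)
    (add : ∀ u v, P u → P v → P (u + v))
    (tmul : ∀ (g : Smooth n) (θ : Grassmann m), θ ∈ grassmannFiltration m k → P (g ⊗ₜ θ))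
    {u : SuperFun n m} (hu : u ∈ superFiltration n m k) : P u := by
  obtain ⟨s, rfl⟩ := hu
  induction s using TensorProduct.induction_on with
  | zero => rwa [map_zero]
  | add s t hs ht => rw [map_add]; exact add _ _ hs ht
  | tmul g θ => exact tmul g θ θ.2

theorem mul_mem_superFiltration {k l : ℕ} {u v : SuperFun n m}
    (hu : u ∈ superFiltration n m k) (hv : v ∈ superFiltration n m l) :
    u * v ∈ superFiltration n m (k + l) := by
  refine superFiltration_induction ?_ ?_ ?_ hu
  · rw [zero_mul]; exact Submodule.zero_mem _
  · intro u u' h h'; rw [add_mul]; exact Submodule.add_mem _ h h'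
  · intro g θ hθ
    refine superFiltration_induction ?_ ?_ ?_ hv
    · rw [mul_zero]; exact Submodule.zero_mem _
    · intro u u' h h'; rw [mul_add]; exact Submodule.add_mem _ h h'
    · intro h η hη
      rw [Algebra.TensorProduct.tmul_mul_tmul]
      exact tmul_mem_superFiltration _ (mul_mem_grassmannFiltration hθ hη)

theorem mem_superFiltration_zero (u : SuperFun n m) : u ∈ superFiltration n m 0 := by
  induction u using TensorProduct.induction_on with
  | zero => exact Submodule.zero_mem _
  | add u v hu hv => exact Submodule.add_mem _ hu hv
  | tmul g θ => exact tmul_mem_superFiltration g (by simp [grassmannFiltration])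

theorem eq_zero_of_mem_superFiltration {u : SuperFun n m}
    (hu : u ∈ superFiltration n m (m + 1)) : u = 0 := by
  refine superFiltration_induction rfl ?_ ?_ hu
  · rintro u v rfl rfl; exact add_zero 0
  · intro g θ hθ
    rw [grassmannFiltration_eq_bot, Submodule.mem_bot] at hθ
    rw [hθ, TensorProduct.tmul_zero]

theorem parityPart_one_le_superFiltration : parityPart n m 1 ≤ superFiltration n m 1 := by
  intro u hu
  refine parityPart_induction (Submodule.zero_mem _) (fun _ _ => Submodule.add_mem _) ?_ hu
  exact fun g θ hθ => tmul_mem_superFiltration g (evenOdd_one_le_grassmannFiltration hθ)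

/-! ### Numerical and nilpotent parts. -/

theorem numPart_tmul (g : Smooth n) (θ : Grassmann m) :
    numPart (g ⊗ₜ[ℝ] θ) = ExteriorAlgebra.algebraMapInv θ • g := by
  simp [numPart]

theorem ofSmooth_apply (g : Smooth n) : ofSmooth n m g = g ⊗ₜ[ℝ] 1 := rfl

theorem nilPart_tmul (g : Smooth n) (θ : Grassmann m) :
    nilPart (g ⊗ₜ[ℝ] θ) =
      g ⊗ₜ[ℝ] (θ - algebraMap ℝ _ (ExteriorAlgebra.algebraMapInv θ)) := by
  rw [nilPart, numPart_tmul, ofSmooth_apply, TensorProduct.smul_tmul, TensorProduct.tmul_sub,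
    Algebra.algebraMap_eq_smul_one]

theorem nilPart_add (u v : SuperFun n m) : nilPart (u + v) = nilPart u + nilPart v := by
  simp only [nilPart, map_add]; abel

theorem nilPart_mem_superFiltration (u : SuperFun n m) : nilPart u ∈ superFiltration n m 1 := by
  induction u using TensorProduct.induction_on with
  | zero => rw [nilPart, map_zero, map_zero, sub_zero]; exact Submodule.zero_mem _
  | add u v hu hv => rw [nilPart_add]; exact Submodule.add_mem _ hu hv
  | tmul g θ => rw [nilPart_tmul]; exact tmul_mem_superFiltration g (sub_algebraMapInv_mem θ)

theorem nilPart_mem_parityPart {u : SuperFun n m} (hu : u ∈ parityPart n m 0) :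
    nilPart u ∈ parityPart n m 0 :=
  Submodule.sub_mem _ hu (ofSmooth_mem_parityPart _)

theorem partialD_inl_ofSmooth (i : Fin n) (g : Smooth n) :
    partialD (Sum.inl i) (ofSmooth n m g) = ofSmooth n m (smoothPartial i g) := rfl

theorem partialD_inr_ofSmooth (μ : Fin m) (g : Smooth n) :
    partialD (Sum.inr μ) (ofSmooth n m g) = 0 := by
  have h : CliffordAlgebra.contractLeft (Q := (0 : QuadraticForm ℝ (Fin m → ℝ)))
      (LinearMap.proj μ) (1 : Grassmann m) = 0 := CliffordAlgebra.contractLeft_one _ _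
  rw [partialD, ofSmooth_apply, LinearMap.lTensor_tmul, h, TensorProduct.tmul_zero]

/-- An odd derivative lowers the degree, so the filtration alone is not enough. But it makes the
even element `nilPart u` odd, and odd elements have no term of degree `0`. -/
theorem partialD_nilPart_mem_superFiltration (a : Index n m) {u : SuperFun n m}
    (hu : u ∈ parityPart n m 0) : partialD a (nilPart u) ∈ superFiltration n m 1 := by
  cases a with
  | inl i =>
    refine superFiltration_induction (P := fun v => partialD (Sum.inl i) v ∈ superFiltration n m 1)
      ?_ ?_ ?_ (nilPart_mem_superFiltration u)
    · rw [map_zero]; exact Submodule.zero_mem _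
    · intro u u' h h'; rw [map_add]; exact Submodule.add_mem _ h h'
    · intro g θ hθ
      rw [partialD, LinearMap.rTensor_tmul]
      exact tmul_mem_superFiltration _ hθ
  | inr μ =>
    have h := partialD_mem_parityPart (Sum.inr μ) (nilPart_mem_parityPart hu)
    rw [parity, add_zero] at h
    exact parityPart_one_le_superFiltration h

end Nilpotency

/-! ### The chain rule -/

theorem smoothPartial_smoothComp {n k : ℕ} (u : Fin k → Smooth n) (i : Fin n) (g : Smooth k) :
    smoothPartial i (smoothComp u g) =
      ∑ j, smoothPartial i (u j) * smoothComp u (smoothPartial j g) := by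
  have hg : ContDiff ℝ ∞ g := g.contMDiff.contDiff
  have hu (j) : ContDiff ℝ ∞ (u j) := (u j).contMDiff.contDiff
  ext x
  have hd : HasFDerivAt (fun x j => u j x)
      (ContinuousLinearMap.pi fun j => fderiv ℝ (u j) x) x :=
    hasFDerivAt_pi.2 fun j => ((hu j).differentiable (by simp) x).hasFDerivAt
  have hc := (hg.differentiable (by simp) fun j => u j x).hasFDerivAt.comp x hd
  have hsum : (∑ j, smoothPartial i (u j) * smoothComp u (smoothPartial j g)) x =
      ∑ j, fderiv ℝ (u j) x (Pi.single i 1) *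
        fderiv ℝ g (fun j => u j x) (Pi.single j 1) := by
    rw [← ContMDiffMap.coeFnAddMonoidHom_apply, map_sum, Finset.sum_apply]
    rfl
  rw [hsum]
  change fderiv ℝ (⇑g ∘ fun x j => u j x) x (Pi.single i 1) = _
  rw [hc.fderiv, ContinuousLinearMap.comp_apply]
  conv_lhs => rw [pi_eq_sum_univ' (ContinuousLinearMap.pi (fun j => fderiv ℝ (u j) x) _), map_sum]
  refine Finset.sum_congr rfl fun j _ => ?_
  rw [map_smul]
  rfl

/-- The contraction of an element of the Grassmann algebra with a coordinate form. -/
def grassmannPartial {m : ℕ} (μ : Fin m) : Module.End ℝ (Grassmann m) :=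
  CliffordAlgebra.contractLeft (Q := (0 : QuadraticForm ℝ (Fin m → ℝ))) (LinearMap.proj μ)

/-! ### Substitution of the even components. -/

namespace SuperMap

variable {n₁ m₁ n₂ m₂ : ℕ} (y : SuperMap n₁ m₁ n₂ m₂)

/-- The numerical part of an even component of a smooth map. -/
def num (i : Fin n₂) : Smooth n₁ := numPart (y.comp (Sum.inl i))

/-- The nilpotent part of an even component of a smooth map. -/
def nil (i : Fin n₂) : SuperFun n₁ m₁ := nilPart (y.comp (Sum.inl i))

theorem nil_mem_parityPart (i : Fin n₂) : y.nil i ∈ parityPart n₁ m₁ 0 :=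
  nilPart_mem_parityPart (y.comp_mem (Sum.inl i))

theorem partialD_nil_mem_superFiltration (a : Index n₁ m₁) (i : Fin n₂) :
    partialD a (y.nil i) ∈ superFiltration n₁ m₁ 1 := by
  have h : y.comp (Sum.inl i) ∈ parityPart n₁ m₁ 0 := y.comp_mem (Sum.inl i)
  exact partialD_nilPart_mem_superFiltration a h

theorem ofSmooth_num_add_nil (i : Fin n₂) :
    ofSmooth n₁ m₁ (y.num i) + y.nil i = y.comp (Sum.inl i) :=
  add_sub_cancel _ _

/-- `k!` times the term of degree `k` of the formal Taylor series of a smooth function `g` at the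
numerical part of the even components of a smooth map. -/
def taylorTerm (k : ℕ) (g : Smooth n₂) : SuperFun n₁ m₁ :=
  ∑ b : Fin k → Fin n₂, (List.ofFn fun j => y.nil (b j)).prod *
    ofSmooth n₁ m₁ (smoothComp y.num
      ((List.ofFn fun j => smoothPartial (b j)).prod g))

theorem evenSubst_apply (g : Smooth n₂) :
    y.evenSubst g = ∑ k ∈ Finset.range (m₁ + 1), (Nat.factorial k : ℝ)⁻¹ • y.taylorTerm k g := by
  simp only [evenSubst, LinearMap.sum_apply, LinearMap.smul_apply]
  rfl

theorem taylorTerm_zero (g : Smooth n₂) :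
    y.taylorTerm 0 g = ofSmooth n₁ m₁ (smoothComp y.num g) := by
  simp [taylorTerm]

theorem taylorTerm_succ (k : ℕ) (g : Smooth n₂) :
    y.taylorTerm (k + 1) g = ∑ i, y.nil i * y.taylorTerm k (smoothPartial i g) := by
  simp only [taylorTerm, Finset.mul_sum]
  rw [← Fintype.sum_prod_type', ← (Fin.consEquiv fun _ : Fin (k + 1) => Fin n₂).sum_comp]
  refine Finset.sum_congr rfl fun p _ => ?_
  -- The split-off derivative is outermost; it has to act on `g` first.
  have hcomm : Commute (smoothPartial p.1) (List.ofFn fun j => smoothPartial (p.2 j)).prod := by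
    refine Commute.list_prod_right _ _ fun T hT => ?_
    obtain ⟨j, rfl⟩ := (List.mem_ofFn' _ _).1 hT
    exact smoothPartial_commute _ _
  simp only [Fin.consEquiv_apply, List.ofFn_succ, Fin.cons_zero, Fin.cons_succ, List.prod_cons,
    hcomm.eq, Module.End.mul_apply, mul_assoc]

theorem taylorTerm_mem_parityPart (k : ℕ) (g : Smooth n₂) :
    y.taylorTerm k g ∈ parityPart n₁ m₁ 0 := by
  induction k generalizing g with
  | zero => rw [taylorTerm_zero]; exact ofSmooth_mem_parityPart _
  | succ k ih =>
    rw [taylorTerm_succ]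
    refine Submodule.sum_mem _ fun i _ => ?_
    have := mul_mem_parityPart (y.nil_mem_parityPart i) (ih (smoothPartial i g))
    rwa [add_zero] at this

theorem evenSubst_mem_parityPart (g : Smooth n₂) : y.evenSubst g ∈ parityPart n₁ m₁ 0 := by
  rw [evenSubst_apply]
  exact Submodule.sum_mem _ fun k _ => Submodule.smul_mem _ _ (y.taylorTerm_mem_parityPart k g)

theorem taylorTerm_mem_superFiltration (k : ℕ) (g : Smooth n₂) :
    y.taylorTerm k g ∈ superFiltration n₁ m₁ k := by
  induction k generalizing g with
  | zero => exact mem_superFiltration_zero _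
  | succ k ih =>
    rw [taylorTerm_succ, add_comm]
    exact Submodule.sum_mem _ fun i _ =>
      mul_mem_superFiltration (nilPart_mem_superFiltration _) (ih _)

theorem partialD_ofSmooth_smoothComp (a : Index n₁ m₁) (g : Smooth n₂) :
    partialD a (ofSmooth n₁ m₁ (smoothComp y.num g)) =
      ∑ i, partialD a (ofSmooth n₁ m₁ (y.num i)) *
        ofSmooth n₁ m₁ (smoothComp y.num (smoothPartial i g)) := by
  cases a with
  | inl j =>
    have hmul (g h : Smooth n₁) : ofSmooth n₁ m₁ (g * h) = ofSmooth n₁ m₁ g * ofSmooth n₁ m₁ h :=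
      map_mul (Algebra.TensorProduct.includeLeft : Smooth n₁ →ₐ[ℝ] SuperFun n₁ m₁) g h
    simp only [partialD_inl_ofSmooth, smoothPartial_smoothComp, map_sum, hmul]
  | inr μ => simp only [partialD_inr_ofSmooth, zero_mul, Finset.sum_const_zero]

/-- The `k` nilpotent factors are even, so they commute and contribute equally: hence the factor
`k`. The second sum is the chain rule at the numerical part. For `k = 0` the truncated `k - 1` is
harmless, as its coefficient is zero. -/
theorem partialD_taylorTerm (a : Index n₁ m₁) (k : ℕ) (g : Smooth n₂) :
    partialD a (y.taylorTerm k g) =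
      (k : ℝ) • ∑ i, partialD a (y.nil i) * y.taylorTerm (k - 1) (smoothPartial i g) +
        ∑ i, partialD a (ofSmooth n₁ m₁ (y.num i)) * y.taylorTerm k (smoothPartial i g) := by
  induction k generalizing g with
  | zero => simp only [taylorTerm_zero, partialD_ofSmooth_smoothComp, Nat.cast_zero, zero_smul,
      zero_add]
  | succ k ih =>
    have hcomm (i j) : smoothPartial i (smoothPartial j g) = smoothPartial j (smoothPartial i g) :=
      LinearMap.congr_fun (smoothPartial_commute i j) g
    have hswap (u v w : SuperFun n₁ m₁) (hu : u ∈ parityPart n₁ m₁ 0) :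
        u * (v * w) = v * (u * w) := by
      rw [← mul_assoc, (commute_of_mem_parityPart_zero hu v).eq, mul_assoc]
    have h1 : (k : ℝ) • ∑ i, y.nil i *
          ∑ j, partialD a (y.nil j) * y.taylorTerm (k - 1) (smoothPartial j (smoothPartial i g)) =
        (k : ℝ) • ∑ j, partialD a (y.nil j) * y.taylorTerm k (smoothPartial j g) := by
      cases k with
      | zero => simp only [Nat.cast_zero, zero_smul]
      | succ k =>
        simp only [Finset.mul_sum, taylorTerm_succ, Nat.add_sub_cancel]
        rw [Finset.sum_comm]
        simp only [hswap _ _ _ (y.nil_mem_parityPart _), hcomm]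
    have h2 : ∑ i, y.nil i * ∑ j, partialD a (ofSmooth n₁ m₁ (y.num j)) *
          y.taylorTerm k (smoothPartial j (smoothPartial i g)) =
        ∑ j, partialD a (ofSmooth n₁ m₁ (y.num j)) * y.taylorTerm (k + 1) (smoothPartial j g) := by
      simp only [Finset.mul_sum, taylorTerm_succ]
      rw [Finset.sum_comm]
      simp only [hswap _ _ _ (y.nil_mem_parityPart _), hcomm]
    rw [← h2, taylorTerm_succ, map_sum]
    simp only [partialD_mul_of_even a (y.nil_mem_parityPart _), ih, mul_add, mul_smul_comm,
      Finset.sum_add_distrib, ← Finset.smul_sum, h1]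
    rw [Nat.add_sub_cancel, Nat.cast_succ, add_smul, one_smul]
    abel

theorem partialD_evenSubst (a : Index n₁ m₁) (g : Smooth n₂) :
    partialD a (y.evenSubst g) =
      ∑ i, partialD a (y.comp (Sum.inl i)) * y.evenSubst (smoothPartial i g) := by
  -- The cutoff of the Taylor sum is consistent: this product has degree at least `1 + m₁` in `m₁`
  -- odd coordinates.
  have h0 (i) : partialD a (y.nil i) * y.taylorTerm m₁ (smoothPartial i g) = 0 := by
    refine eq_zero_of_mem_superFiltration ?_
    rw [add_comm]
    exact mul_mem_superFiltration (y.partialD_nil_mem_superFiltration a i)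
      (y.taylorTerm_mem_superFiltration _ _)
  have h1 : ∑ k ∈ Finset.range (m₁ + 1), (Nat.factorial k : ℝ)⁻¹ • (k : ℝ) •
        ∑ i, partialD a (y.nil i) * y.taylorTerm (k - 1) (smoothPartial i g) =
      ∑ i, partialD a (y.nil i) * y.evenSubst (smoothPartial i g) := by
    have h2 (i) : partialD a (y.nil i) * y.evenSubst (smoothPartial i g) =
        ∑ k ∈ Finset.range m₁, (Nat.factorial k : ℝ)⁻¹ •
          (partialD a (y.nil i) * y.taylorTerm k (smoothPartial i g)) := by
      rw [evenSubst_apply, Finset.sum_range_succ, mul_add, mul_smul_comm, h0, smul_zero, add_zero,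
        Finset.mul_sum]
      simp only [mul_smul_comm]
    simp only [h2]
    -- The term `k = 0` drops out; the shift `k ↦ k + 1` then uses `(k + 1) / (k + 1)! = 1 / k!`.
    rw [Finset.sum_comm, Finset.sum_range_succ', Nat.cast_zero, zero_smul, smul_zero, add_zero]
    refine Finset.sum_congr rfl fun k _ => ?_
    rw [← Finset.smul_sum, smul_smul, Nat.add_sub_cancel, Nat.factorial_succ, Nat.cast_mul,
      mul_inv_rev, mul_assoc, inv_mul_cancel₀ (Nat.cast_ne_zero.2 k.succ_ne_zero), mul_one]
  conv_lhs => rw [evenSubst_apply, map_sum]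
  simp only [map_smul, partialD_taylorTerm, smul_add, Finset.sum_add_distrib, h1]
  have h3 : ∑ k ∈ Finset.range (m₁ + 1), (Nat.factorial k : ℝ)⁻¹ •
        ∑ i, partialD a (ofSmooth n₁ m₁ (y.num i)) * y.taylorTerm k (smoothPartial i g) =
      ∑ i, partialD a (ofSmooth n₁ m₁ (y.num i)) * y.evenSubst (smoothPartial i g) := by
    simp only [evenSubst_apply, Finset.mul_sum, Finset.smul_sum, mul_smul_comm]
    exact Finset.sum_comm
  rw [h3, ← Finset.sum_add_distrib]
  refine Finset.sum_congr rfl fun i _ => ?_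
  rw [← add_mul, ← map_add, add_comm, ofSmooth_num_add_nil]

/-! ### Substitution of the odd components. -/

theorem oddLinear_mem_parityPart (v : Fin m₂ → ℝ) : y.oddLinear v ∈ parityPart n₁ m₁ 1 := by
  rw [oddLinear, Fintype.linearCombination_apply]
  exact Submodule.sum_mem _ fun α _ => Submodule.smul_mem _ _ (y.comp_mem (Sum.inr α))

theorem oddSubst_ι_mul (v : Fin m₂ → ℝ) (θ : Grassmann m₂) :
    y.oddSubst (ExteriorAlgebra.ι ℝ v * θ) = y.oddLinear v * y.oddSubst θ := by
  rw [map_mul, oddSubst, ExteriorAlgebra.lift_ι_apply]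

theorem partialD_oddSubst (a : Index n₁ m₁) (θ : Grassmann m₂) :
    partialD a (y.oddSubst θ) =
      ∑ μ, partialD a (y.comp (Sum.inr μ)) * y.oddSubst (grassmannPartial μ θ) := by
  induction θ using grassmann_induction with
  | algebraMap r =>
    have h1 (μ : Fin m₂) : grassmannPartial μ (algebraMap ℝ (Grassmann m₂) r) = 0 :=
      CliffordAlgebra.contractLeft_algebraMap _ _ _
    have h2 : partialD a (1 : SuperFun n₁ m₁) = 0 := by
      -- The Leibniz rule for `1 * 1` reads `∂1 = ∂1 + ∂1`.
      have := partialD_mul_of_even a (one_mem_parityPart (n := n₁) (m := m₁)) 1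
      simpa using this
    rw [AlgHom.commutes, Algebra.algebraMap_eq_smul_one, map_smul, h2, smul_zero]
    exact (Finset.sum_eq_zero fun μ _ => by rw [h1, map_zero, mul_zero]).symm
  | add x y hx hy => simp only [map_add, hx, hy, mul_add, Finset.sum_add_distrib]
  | ι_mul θ v ih =>
    have h1 (μ : Fin m₂) : grassmannPartial μ (ExteriorAlgebra.ι ℝ v * θ) =
        v μ • θ - ExteriorAlgebra.ι ℝ v * grassmannPartial μ θ :=
      CliffordAlgebra.contractLeft_ι_mul _ _ _
    have h2 : partialD a (y.oddLinear v) = ∑ μ, v μ • partialD a (y.comp (Sum.inr μ)) := by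
      rw [oddLinear, Fintype.linearCombination_apply]
      simp only [map_sum, map_smul]
    -- The swap costs `ã + 1`, the Leibniz rule costs `ã`. The total is `-1`, the sign in the
    -- contraction rule for `ι v * θ`.
    have h3 (μ : Fin m₂) (w : SuperFun n₁ m₁) :
        sign (parity a) • (y.oddLinear v * (partialD a (y.comp (Sum.inr μ)) * w)) =
          -(partialD a (y.comp (Sum.inr μ)) * (y.oddLinear v * w)) := by
      rw [← mul_assoc, mul_comm_of_mem_parityPart (y.oddLinear_mem_parityPart v)
        (partialD_mem_parityPart a (y.comp_mem (Sum.inr μ))), smul_mul_assoc, smul_smul, ← sign_add,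
        mul_assoc, one_mul, ← add_assoc, CharTwo.add_self_eq_zero, zero_add]
      exact sign_one_smul _
    rw [oddSubst_ι_mul, partialD_mul a (y.oddLinear_mem_parityPart v), mul_one, ih, h2]
    simp only [h1, map_sub, map_smul, oddSubst_ι_mul, mul_sub, Finset.sum_sub_distrib,
      Finset.mul_sum, Finset.smul_sum, h3, Finset.sum_neg_distrib, Finset.sum_mul, smul_mul_assoc,
      mul_smul_comm]
    rw [sub_eq_add_neg]

theorem pullback_tmul (g : Smooth n₂) (θ : Grassmann m₂) :
    y.pullback (g ⊗ₜ[ℝ] θ) = y.evenSubst g * y.oddSubst θ := rfl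

theorem partialD_inr_tmul {n m : ℕ} (μ : Fin m) (g : Smooth n) (θ : Grassmann m) :
    partialD (Sum.inr μ) (g ⊗ₜ[ℝ] θ) = g ⊗ₜ[ℝ] grassmannPartial μ θ := rfl

/-- The chain rule for the substitution of a smooth map of superspaces. -/
theorem partialD_pullback (a : Index n₁ m₁) (f : SuperFun n₂ m₂) :
    partialD a (y.pullback f) = ∑ b, partialD a (y.comp b) * y.pullback (partialD b f) := by
  induction f using TensorProduct.induction_on with
  | zero => simp
  | add f g hf hg => simp only [map_add, hf, hg, mul_add, Finset.sum_add_distrib]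
  | tmul g θ =>
    rw [pullback_tmul, partialD_mul_of_even a (y.evenSubst_mem_parityPart g), partialD_evenSubst,
      partialD_oddSubst, Fintype.sum_sum_type, Finset.sum_mul, Finset.mul_sum]
    congr 1
    · refine Finset.sum_congr rfl fun i _ => ?_
      rw [mul_assoc, partialD, LinearMap.rTensor_tmul, pullback_tmul]
    · refine Finset.sum_congr rfl fun μ _ => ?_
      rw [partialD_inr_tmul, pullback_tmul, ← mul_assoc, ← mul_assoc,
        (commute_of_mem_parityPart_zero (y.evenSubst_mem_parityPart g) _).eq]

end SuperMap

/-! ### Iterated derivatives and ordered products -/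

section Iterated

variable {n m : ℕ}

theorem iterD_succ {k : ℕ} (c : Fin (k + 1) → Index n m) (u : SuperFun n m) :
    iterD c u = partialD (c 0) (iterD (fun j => c j.succ) u) := by
  rw [iterD, List.ofFn_succ, List.prod_cons]
  rfl

/-- The iterated derivative with respect to a list of indices (the last one acts first). -/
def listD (l : List (Index n m)) : Module.End ℝ (SuperFun n m) :=
  (l.map partialD).prod

/-- The total parity of a list of indices. -/
def listParity (l : List (Index n m)) : ZMod 2 :=
  (l.map parity).sum

theorem listD_cons (a : Index n m) (l : List (Index n m)) (u : SuperFun n m) :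
    listD (a :: l) u = partialD a (listD l u) := by
  rw [listD, List.map_cons, List.prod_cons]
  rfl

theorem listParity_cons (a : Index n m) (l : List (Index n m)) :
    listParity (a :: l) = parity a + listParity l := by
  rw [listParity, List.map_cons, List.sum_cons]
  rfl

/-- Blocks are handled as lists because a family on `Fin (π.partSize i)` changes its type when the
block grows. -/
theorem listD_ofFn {k : ℕ} (c : Fin k → Index n m) : listD (List.ofFn c) = iterD c := by
  rw [listD, List.map_ofFn]
  rfl

theorem listParity_ofFn {k : ℕ} (c : Fin k → Index n m) :
    listParity (List.ofFn c) = ∑ j, parity (c j) := by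
  rw [listParity, List.map_ofFn, List.sum_ofFn]
  rfl

theorem listD_mem_parityPart (l : List (Index n m)) {p : ZMod 2} {u : SuperFun n m}
    (hu : u ∈ parityPart n m p) : listD l u ∈ parityPart n m (listParity l + p) := by
  induction l with
  | nil => simpa [listD, listParity] using hu
  | cons a l ih =>
    rw [listD_cons, listParity_cons, add_assoc]
    exact partialD_mem_parityPart _ ih

theorem prod_ofFn_mem_parityPart {k : ℕ} (F : Fin k → SuperFun n m) (p : Fin k → ZMod 2)
    (hF : ∀ i, F i ∈ parityPart n m (p i)) :
    (List.ofFn F).prod ∈ parityPart n m (∑ i, p i) := by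
  induction k with
  | zero => simpa using one_mem_parityPart
  | succ k ih =>
    rw [List.ofFn_succ, List.prod_cons, Fin.sum_univ_succ]
    exact mul_mem_parityPart (hF 0) (ih _ _ fun i => hF i.succ)

theorem prod_ofFn_sign_smul {k : ℕ} (p : Fin k → ZMod 2) (F : Fin k → SuperFun n m) :
    (List.ofFn fun i => sign (p i) • F i).prod = sign (∑ i, p i) • (List.ofFn F).prod := by
  induction k with
  | zero => simp
  | succ k ih =>
    rw [List.ofFn_succ, List.prod_cons, List.ofFn_succ, List.prod_cons, Fin.sum_univ_succ, ih,
      sign_add, smul_mul_assoc, mul_smul_comm, smul_smul]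

theorem sum_lt_succ {k : ℕ} (p : Fin (k + 1) → ZMod 2) (i : Fin k) :
    ∑ j with j < i.succ, p j = p 0 + ∑ j with j < i, p j.succ := by
  simp [Finset.sum_filter, Fin.sum_univ_succ]

/-- The Leibniz rule for the derivative of an ordered product. -/
theorem partialD_prod_ofFn_mul (a : Index n m) {k : ℕ} (F : Fin k → SuperFun n m)
    (p : Fin k → ZMod 2) (hF : ∀ i, F i ∈ parityPart n m (p i)) (v : SuperFun n m) :
    partialD a ((List.ofFn F).prod * v) =
      (∑ i, sign (parity a * ∑ j with j < i, p j) •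
        ((List.ofFn (Function.update F i (partialD a (F i)))).prod * v)) +
      sign (parity a * ∑ i, p i) • ((List.ofFn F).prod * partialD a v) := by
  induction k with
  | zero => simp
  | succ k ih =>
    have h0 : (List.ofFn (Function.update F 0 (partialD a (F 0)))).prod =
        partialD a (F 0) * (List.ofFn fun j : Fin k => F j.succ).prod := by
      simp [List.ofFn_succ]
    have hs (i : Fin k) :
        (List.ofFn (Function.update F i.succ (partialD a (F i.succ)))).prod =
          F 0 * (List.ofFn (Function.update (fun j : Fin k => F j.succ) i
            (partialD a (F i.succ)))).prod := by
      rw [List.ofFn_succ, List.prod_cons, Function.update_of_ne (Fin.succ_ne_zero i).symm]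
      congr 3
      exact Function.update_comp_eq_of_injective F (Fin.succ_injective k) i _
    rw [Fin.sum_univ_succ, Fin.sum_univ_succ, h0]
    simp only [hs, sum_lt_succ, mul_add, sign_add, mul_smul]
    rw [List.ofFn_succ, List.prod_cons, mul_assoc, partialD_mul a (hF 0),
      ih _ (fun i => p i.succ) (fun i => hF i.succ)]
    simp only [mul_add, Finset.mul_sum, mul_smul_comm, smul_add, Finset.smul_sum, mul_assoc]
    simp [add_assoc]

end Iterated

/-! ### The differentiation of a term -/

namespace SuperMap

variable {n₁ m₁ n₂ m₂ L : ℕ} (y : SuperMap n₁ m₁ n₂ m₂)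

/-- The exponent of the sign that arises from blocks `B` and indices `b`. -/
def blocksParity (B : Fin L → List (Index n₁ m₁)) (b : Fin L → Index n₂ m₂) : ZMod 2 :=
  ∑ i, parity (b i) * ∑ k with i < k, (parity (b k) + listParity (B k))

/-- The term of the super Faà di Bruno formula with blocks `B` and indices `b`. -/
def blocksTerm (f : SuperFun n₂ m₂) (s : ZMod 2) (B : Fin L → List (Index n₁ m₁))
    (b : Fin L → Index n₂ m₂) : SuperFun n₁ m₁ :=
  sign (s + blocksParity B b) •
    ((List.ofFn fun i => listD (B i) (y.comp (b i))).prod * y.pullback (iterD b f))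

/-- The sum over `b` of the terms of the super Faà di Bruno formula with blocks `B`. -/
def blocksSum (f : SuperFun n₂ m₂) (s : ZMod 2) (B : Fin L → List (Index n₁ m₁)) :
    SuperFun n₁ m₁ :=
  ∑ b, y.blocksTerm f s B b

theorem blocksParity_cons (a : Index n₁ m₁) (B : Fin L → List (Index n₁ m₁))
    (b₀ : Index n₂ m₂) (b : Fin L → Index n₂ m₂) :
    blocksParity (Fin.cons [a] B : Fin (L + 1) → _) (Fin.cons b₀ b : Fin (L + 1) → _) =
      blocksParity B b + parity b₀ * ∑ k, (listParity (B k) + parity (b k)) := by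
  simp [blocksParity, Finset.sum_filter, Fin.sum_univ_succ, add_comm]

/-- The block `i` enters only the exponents of the blocks `k < i`. -/
theorem blocksParity_update (a : Index n₁ m₁) (B : Fin L → List (Index n₁ m₁))
    (b : Fin L → Index n₂ m₂) (i : Fin L) :
    blocksParity (Function.update B i (a :: B i)) b =
      blocksParity B b + parity a * ∑ k with k < i, parity (b k) := by
  have h (k : Fin L) : listParity (Function.update B i (a :: B i) k) =
      listParity (B k) + if k = i then parity a else 0 := by
    by_cases hk : k = i
    · subst hk
      rw [Function.update_self, listParity_cons, if_pos rfl, add_comm]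
    · rw [Function.update_of_ne hk, if_neg hk, add_zero]
  simp only [blocksParity, h, ← add_assoc]
  rw [Finset.mul_sum, Finset.sum_filter, ← Finset.sum_add_distrib]
  refine Finset.sum_congr rfl fun k _ => ?_
  rw [Finset.sum_add_distrib, mul_add, Finset.sum_ite_eq']
  simp [mul_comm]

theorem blocksTerm_cons (f : SuperFun n₂ m₂) (s : ZMod 2) (a : Index n₁ m₁)
    (B : Fin L → List (Index n₁ m₁)) (b₀ : Index n₂ m₂) (b : Fin L → Index n₂ m₂) :
    y.blocksTerm f s (Fin.cons [a] B : Fin (L + 1) → _) (Fin.cons b₀ b : Fin (L + 1) → _) =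
      sign (s + blocksParity B b) • sign (parity a *
          ∑ k, (listParity (B k) + parity (b k))) •
        ((List.ofFn fun i => listD (B i) (y.comp (b i))).prod *
          (partialD a (y.comp b₀) * y.pullback (partialD b₀ (iterD b f)))) := by
  have h1 : listD [a] (y.comp b₀) = partialD a (y.comp b₀) := by simp [listD]
  rw [blocksTerm, blocksParity_cons, List.ofFn_succ, List.prod_cons, iterD_succ]
  simp only [Fin.cons_zero, Fin.cons_succ, h1]
  rw [← mul_assoc (List.prod _), mul_comm_of_mem_parityPart
    (prod_ofFn_mem_parityPart _ _ fun i => listD_mem_parityPart (B i) (y.comp_mem (b i)))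
    (partialD_mem_parityPart a (y.comp_mem b₀)), smul_mul_assoc, smul_smul,
    smul_smul, ← sign_add, ← sign_add]
  congr 2
  -- Modulo 2, `ã P` for the Leibniz rule and `(ã + b̃₀) P` for the swap leave `b̃₀ P`.
  generalize ∑ k, (listParity (B k) + parity (b k)) = P
  linear_combination -(CharTwo.add_self_eq_zero (parity a * P))

theorem blocksTerm_update (f : SuperFun n₂ m₂) (s : ZMod 2) (a : Index n₁ m₁)
    (B : Fin L → List (Index n₁ m₁)) (b : Fin L → Index n₂ m₂) (i : Fin L) :
    y.blocksTerm f (s + parity a * ∑ k with k < i, listParity (B k))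
        (Function.update B i (a :: B i)) b =
      sign (s + blocksParity B b) • sign (parity a *
          ∑ k with k < i, (listParity (B k) + parity (b k))) •
        ((List.ofFn (Function.update (fun i => listD (B i) (y.comp (b i))) i
          (partialD a (listD (B i) (y.comp (b i)))))).prod * y.pullback (iterD b f)) := by
  have h : (fun k => listD (Function.update B i (a :: B i) k) (y.comp (b k))) =
      Function.update (fun i => listD (B i) (y.comp (b i))) i
        (partialD a (listD (B i) (y.comp (b i)))) := by
    refine Function.eq_update_iff.2 ⟨?_, fun k hk => ?_⟩
    · rw [Function.update_self, listD_cons]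
    · rw [Function.update_of_ne hk]
  rw [blocksTerm, h, blocksParity_update, smul_smul, ← sign_add, Finset.sum_add_distrib]
  congr 2
  ring

/-- The induction step, freed from partitions: the blocks are arbitrary lists and `s` stands for
`π̃`. -/
theorem partialD_blocksSum (f : SuperFun n₂ m₂) (s : ZMod 2) (a : Index n₁ m₁)
    (B : Fin L → List (Index n₁ m₁)) :
    partialD a (y.blocksSum f s B) =
      y.blocksSum f s (Fin.cons [a] B : Fin (L + 1) → _) +
        ∑ i, y.blocksSum f (s + parity a * ∑ k with k < i, listParity (B k))
          (Function.update B i (a :: B i)) := by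
  have h : y.blocksSum f s (Fin.cons [a] B : Fin (L + 1) → _) =
      ∑ b : Fin L → Index n₂ m₂, ∑ b₀,
        y.blocksTerm f s (Fin.cons [a] B : Fin (L + 1) → _) (Fin.cons b₀ b : Fin (L + 1) → _) := by
    rw [blocksSum, ← (Fin.consEquiv fun _ : Fin (L + 1) => Index n₂ m₂).sum_comp,
      Fintype.sum_prod_type, Finset.sum_comm]
    rfl
  rw [h]
  simp only [blocksSum, map_sum]
  rw [Finset.sum_comm (s := (Finset.univ : Finset (Fin L))), ← Finset.sum_add_distrib]
  refine Finset.sum_congr rfl fun b _ => ?_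
  rw [blocksTerm, map_sign_smul, partialD_prod_ofFn_mul a _ _
    fun i => listD_mem_parityPart (B i) (y.comp_mem (b i)), partialD_pullback]
  simp only [blocksTerm_cons, blocksTerm_update]
  rw [smul_add, add_comm]
  simp only [Finset.mul_sum, Finset.smul_sum]

end SuperMap

/-! ### Extensions of ordered partitions -/

section Partitions

variable {n N M : ℕ}

theorem index_eq_of_emb_eq (π : OrderedFinpartition n) {k : Fin π.length}
    {j : Fin (π.partSize k)} {p : Fin n} (h : π.emb k j = p) : π.index p = k := by
  by_contra hk
  exact π.emb_ne_emb_of_ne (Ne.symm hk) (h.trans (π.emb_invEmbedding p).symm)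

theorem index_emb (π : OrderedFinpartition n) (k : Fin π.length) (j : Fin (π.partSize k)) :
    π.index (π.emb k j) = k :=
  index_eq_of_emb_eq π rfl

theorem index_extendLeft_succ (π : OrderedFinpartition n) (p : Fin n) :
    (π.extendLeft.index p.succ : ℕ) = π.index p + 1 :=
  congrArg Fin.val (index_eq_of_emb_eq π.extendLeft (k := (π.index p).succ)
    (j := π.invEmbedding p) (congrArg Fin.succ (π.emb_invEmbedding p)))

theorem index_extendLeft_zero (π : OrderedFinpartition n) :
    (π.extendLeft.index 0 : ℕ) = 0 :=
  congrArg Fin.val (index_eq_of_emb_eq π.extendLeft (k := (0 : Fin (π.length + 1)))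
    (j := (0 : Fin 1)) rfl)

theorem extendMiddle_partSize_self (π : OrderedFinpartition n) (i : Fin π.length) :
    (π.extendMiddle i).partSize i = π.partSize i + 1 :=
  Function.update_self _ _ _

theorem extendMiddle_partSize_of_ne (π : OrderedFinpartition n) {i k : Fin π.length}
    (hk : k ≠ i) : (π.extendMiddle i).partSize k = π.partSize k :=
  Function.update_of_ne hk _ _

theorem extendMiddle_emb_self (π : OrderedFinpartition n) (i : Fin π.length) :
    (π.extendMiddle i).emb i =
      (Fin.cons 0 (Fin.succ ∘ π.emb i) : Fin (π.partSize i + 1) → Fin (n + 1)) ∘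
        Fin.cast (extendMiddle_partSize_self π i) := by
  simp only [OrderedFinpartition.extendMiddle, dif_pos]
  rfl

theorem extendMiddle_emb_of_ne (π : OrderedFinpartition n) {i k : Fin π.length} (hk : k ≠ i) :
    (π.extendMiddle i).emb k =
      (Fin.succ ∘ π.emb k) ∘ Fin.cast (extendMiddle_partSize_of_ne π hk) := by
  simp only [OrderedFinpartition.extendMiddle, dif_neg hk]
  rfl

theorem index_extendMiddle_zero (π : OrderedFinpartition n) (i : Fin π.length) :
    ((π.extendMiddle i).index 0 : ℕ) = i :=
  congrArg Fin.val (π.index_extendMiddle_zero i)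

theorem index_extendMiddle_succ (π : OrderedFinpartition n) (i : Fin π.length) (p : Fin n) :
    ((π.extendMiddle i).index p.succ : ℕ) = π.index p := by
  refine congrArg Fin.val (a₂ := π.index p) ?_
  by_cases h : π.index p = i
  · subst h
    refine index_eq_of_emb_eq (π.extendMiddle _) (k := π.index p)
      (j := Fin.cast (extendMiddle_partSize_self π _).symm (π.invEmbedding p).succ) ?_
    rw [extendMiddle_emb_self]
    simp
  · refine index_eq_of_emb_eq (π.extendMiddle i) (k := π.index p)
      (j := Fin.cast (extendMiddle_partSize_of_ne π h).symm (π.invEmbedding p)) ?_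
    rw [extendMiddle_emb_of_ne π h]
    simp

variable (a : Fin (n + 1) → Index N M)

/-- Within one block the larger label comes first, so a pair `i < j` counts only when the blocks
differ. -/
theorem partitionParity_eq_sum {n : ℕ} (π : OrderedFinpartition n) (a : Fin n → Index N M) :
    partitionParity π a = ∑ i, ∑ j, if i < j ∧ π.index i.rev < π.index j.rev then
      parity (a i) * parity (a j) else 0 := by
  rw [partitionParity, Finset.sum_filter, Fintype.sum_prod_type]
  refine Finset.sum_congr rfl fun i _ => Finset.sum_congr rfl fun j _ => ?_
  refine if_congr (and_congr_right fun hij => ?_) rfl rfl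
  rw [rank, rank, Prod.Lex.toLex_lt_toLex]
  refine or_iff_left fun h => ?_
  exact absurd (Fin.rev_lt_rev.1 h.2) hij.not_gt

/-- The newest label is the largest and sits at position `0`, so it occurs only as the second member
of a pair, with the labels in earlier blocks. -/
theorem partitionParity_succ (π : OrderedFinpartition (n + 1)) :
    partitionParity π a =
      (∑ i : Fin n, ∑ j : Fin n, if i < j ∧ π.index i.rev.succ < π.index j.rev.succ then
        parity (a i.castSucc) * parity (a j.castSucc) else 0) +
      (∑ p : Fin n, if π.index p.succ < π.index 0 then parity (a p.rev.castSucc) else 0) *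
        parity (a (Fin.last n)) := by
  rw [partitionParity_eq_sum, Fin.sum_univ_castSucc]
  have hlast (j : Fin (n + 1)) : ¬ Fin.last n < j := (Fin.le_last j).not_gt
  simp only [hlast, false_and, if_false, Finset.sum_const_zero, add_zero, Fin.sum_univ_castSucc,
    Finset.sum_add_distrib, Fin.castSucc_lt_castSucc_iff, Fin.castSucc_lt_last, true_and,
    Fin.rev_last, Fin.rev_castSucc]
  congr 1
  rw [Finset.sum_mul, ← Equiv.sum_comp Fin.revPerm]
  refine Finset.sum_congr rfl fun p _ => ?_
  simp [ite_mul]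

/-- The blocks of a partition of the ordered set `{a_n, …, a_1}`. -/
def blocks {n : ℕ} (π : OrderedFinpartition n) (a : Fin n → Index N M) (k : Fin π.length) :
    List (Index N M) :=
  List.ofFn (blockIndices π a k)

theorem ofFn_comp_cast {α : Type*} {k l : ℕ} (h : k = l) (v : Fin l → α) :
    List.ofFn (fun j => v (Fin.cast h j)) = List.ofFn v := by
  subst h
  rfl

theorem blocks_extendLeft (π : OrderedFinpartition n) :
    blocks π.extendLeft a = (Fin.cons [a (Fin.last n)] (blocks π fun p => a p.castSucc) :
      Fin (π.length + 1) → List (Index N M)) := by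
  funext k
  refine Fin.cases (motive := fun k : Fin (π.length + 1) => blocks π.extendLeft a k =
    (Fin.cons [a (Fin.last n)] (blocks π fun p => a p.castSucc) :
      Fin (π.length + 1) → List (Index N M)) k) ?_ (fun k => ?_) k
  · rw [Fin.cons_zero]
    change List.ofFn (fun _ : Fin 1 => a (Fin.rev 0)) = _
    simp
  · rw [Fin.cons_succ]
    change List.ofFn (fun j : Fin (π.partSize k) => a (Fin.rev (Fin.succ (π.emb k j)))) = _
    simp only [Fin.rev_succ]
    rfl

theorem blocks_extendMiddle (π : OrderedFinpartition n) (i : Fin π.length) :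
    blocks (π.extendMiddle i) a = Function.update (blocks π fun p => a p.castSucc) i
      (a (Fin.last n) :: blocks π (fun p => a p.castSucc) i) := by
  refine Function.eq_update_iff.2 ⟨?_, fun k hk => ?_⟩
  · refine (congrArg (fun e => List.ofFn fun j => a (e j).rev) (extendMiddle_emb_self π i)).trans ?_
    refine (ofFn_comp_cast (extendMiddle_partSize_self π i)
      fun j => a ((Fin.cons 0 (Fin.succ ∘ π.emb i) : Fin (π.partSize i + 1) → _) j).rev).trans ?_
    rw [List.ofFn_succ]
    simp only [Fin.cons_zero, Fin.cons_succ, Function.comp_apply, Fin.rev_zero, Fin.rev_succ]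
    rfl
  · refine (congrArg (fun e => List.ofFn fun j => a (e j).rev)
      (extendMiddle_emb_of_ne π hk)).trans ?_
    refine (ofFn_comp_cast (extendMiddle_partSize_of_ne π hk)
      fun j => a (π.emb k j).succ.rev).trans ?_
    simp only [Fin.rev_succ]
    rfl

/-- Nothing precedes the new label, so no pair is added. -/
theorem partitionParity_extendLeft (π : OrderedFinpartition n) :
    partitionParity π.extendLeft a = partitionParity π fun p => a p.castSucc := by
  rw [partitionParity_succ, partitionParity_eq_sum]
  simp only [Fin.lt_def, index_extendLeft_succ, index_extendLeft_zero]
  simp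

theorem partitionParity_extendMiddle (π : OrderedFinpartition n) (i : Fin π.length) :
    partitionParity (π.extendMiddle i) a =
      partitionParity π (fun p => a p.castSucc) + parity (a (Fin.last n)) *
        ∑ k with k < i, listParity (blocks π (fun p => a p.castSucc) k) := by
  have h : ∑ p : Fin n, (if (π.index p : ℕ) < i then parity (a p.rev.castSucc) else 0) =
      ∑ k with k < i, listParity (blocks π (fun p => a p.castSucc) k) := by
    -- The positions are regrouped by blocks; the condition then depends on the block alone.
    rw [← π.sum_sigma_eq_sum, Finset.sum_filter]
    refine Finset.sum_congr rfl fun k _ => ?_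
    simp only [index_emb, ← Fin.lt_def, blocks, listParity_ofFn]
    split_ifs
    · rfl
    · exact Finset.sum_const_zero
  rw [partitionParity_succ, partitionParity_eq_sum]
  simp only [Fin.lt_def, index_extendMiddle_succ, index_extendMiddle_zero] at h ⊢
  rw [h, mul_comm]

end Partitions

/-! ### The super Faà di Bruno formula -/

namespace SuperMap

variable {n₁ m₁ n₂ m₂ : ℕ} (y : SuperMap n₁ m₁ n₂ m₂)

theorem iterD_pullback (f : SuperFun n₂ m₂) (n : ℕ) (a : Fin n → Index n₁ m₁) :
    iterD (fun p => a p.rev) (y.pullback f) =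
      ∑ π : OrderedFinpartition n, y.blocksSum f (partitionParity π a) (blocks π a) := by
  induction n with
  | zero =>
    have h (B : Fin 0 → List (Index n₁ m₁)) : y.blocksSum f 0 B = y.pullback f := by
      simp [blocksSum, blocksTerm, blocksParity, iterD]
    rw [Fintype.sum_unique]
    have hp : partitionParity (default : OrderedFinpartition 0) a = 0 := by
      simp [partitionParity]
    rw [hp]
    refine Eq.trans ?_ (h (blocks (default : OrderedFinpartition 0) a)).symm
    simp [iterD]
  | succ n ih =>
    have h : iterD (fun p : Fin (n + 1) => a p.rev) (y.pullback f) =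
        partialD (a (Fin.last n))
          (iterD (fun p : Fin n => a p.rev.castSucc) (y.pullback f)) := by
      rw [iterD_succ, Fin.rev_zero]
      simp only [Fin.rev_succ]
    rw [h, ih fun p => a p.castSucc, ← (OrderedFinpartition.extendEquiv n).sum_comp,
      Fintype.sum_sigma, map_sum]
    refine Finset.sum_congr rfl fun π _ => ?_
    rw [Fintype.sum_option, partialD_blocksSum]
    refine congrArg₂ (· + ·) ?_ (Finset.sum_congr rfl fun i _ => ?_)
    -- The number of blocks of `π.extendLeft` is `π.length + 1` only by unfolding, so the equalities
    -- are chained with `L` given explicitly.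
    · refine Eq.trans ?_ (congrArg (fun s => y.blocksSum f s (blocks π.extendLeft a))
        (partitionParity_extendLeft a π).symm)
      exact congrArg (y.blocksSum f (L := π.length + 1) _) (blocks_extendLeft a π).symm
    · refine Eq.trans ?_ (congrArg (fun s => y.blocksSum f s (blocks (π.extendMiddle i) a))
        (partitionParity_extendMiddle a π i).symm)
      exact congrArg (y.blocksSum f (L := π.length) _) (blocks_extendMiddle a π i).symm

end SuperMap

end SuperCalc

end

/-- The super Faà di Bruno formula. -/
theorem mainTheorem1 {n₁ m₁ n₂ m₂ : ℕ} (y : SuperCalc.SuperMap n₁ m₁ n₂ m₂)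
    (f : SuperCalc.SuperFun n₂ m₂) (n : ℕ) (a : Fin n → SuperCalc.Index n₁ m₁) :
    SuperCalc.iterD (fun p => a p.rev) (y.pullback f) =
      ∑ π : OrderedFinpartition n, ∑ b : Fin π.length → SuperCalc.Index n₂ m₂,
        SuperCalc.sign (SuperCalc.partitionParity π a) •
          ((List.ofFn fun i : Fin π.length =>
              SuperCalc.sign (SuperCalc.internalParity π a b i) •
                SuperCalc.iterD (SuperCalc.blockIndices π a i) (y.comp (b i))).prod *
            y.pullback (SuperCalc.iterD b f)) := by
  rw [y.iterD_pullback]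
  refine Finset.sum_congr rfl fun π _ => Finset.sum_congr rfl fun b _ => ?_
  -- The internal signs are scalars, so they leave the ordered product and merge with the sign of
  -- `π̃`.
  rw [SuperCalc.prod_ofFn_sign_smul, smul_mul_assoc, smul_smul, ← SuperCalc.sign_add,
    SuperCalc.SuperMap.blocksTerm]
  simp only [SuperCalc.SuperMap.blocksParity, SuperCalc.blocks, SuperCalc.listParity_ofFn,
    SuperCalc.listD_ofFn]
  rfl
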